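/- An $n\times n$ alternating sign matrix (ASM) is a matrix $B=(b_{i,j})$ with entries in $\{0,1,-1\}$ such that every row and every column sums to $1$ and all initial partial sums of rows and columns lie in $\{0,1\}$ (equivalently, in each row and column the nonzero entries alternate in sign and sum to $1$). Let $N(B)$ be the number of entries of $B$ equal to $-1$, let $\mathrm{Inv}(B)=\sum_{i<j,\;k<\ell} b_{i,\ell}\,b_{j,k}$ be its inversion number (one has $\mathrm{Inv}(B)\ge N(B)$), and let $$Z_{ASM}^{(n)}(x,y)=\sum_{B\ n\times n\ \mathrm{ASM}} x^{N(B)}\,y^{\mathrm{Inv}(B)-N(B)} .$$ Theorem. Let $x,y,\nu$ be elements of a commutative ring $R$ (for instance $R=\mathbb C$), where $\nu$ is any solution of $$x\,\nu(1-\nu)=\nu+y(1-\nu).$$ Let $G=(G_{i,j})_{i,j\ge 0}$ be the infinite matrix with $\sum_{i,j\ge0}G_{i,j}z^iw^j=\dfrac{1}{1-zx-w-(y-x)zw}$ as formal power series in $z,w$, and let $M_{ASM}=(1-\nu)\mathbb I+\nu G$. Then the generating function of $M_{ASM}$ is $$\sum_{i,j\ge 0}(M_{ASM})_{i,j}\,z^iw^j=\frac{1-\nu}{1-zw}+\frac{\nu}{1-zx-w-(y-x)zw},$$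 and for every $n\ge 0$ the refined ASM partition function is the principal minor of $M_{ASM}$ on its first $n$ rows and columns: $$Z_{ASM}^{(n)}(x,y)=\det_{0\le i,j\le n-1}\big((1-\nu)\mathbb I+\nu G\big).$$ -/

import Mathlib

open scoped Matrix

/-- `B` is an alternating sign matrix: all entries are `0`, `1` or `-1`, every row and every column
sums to `1`, and every initial partial row or column sum is `0` or `1` (that is, in each row and
column the nonzero entries alternate in sign, beginning and ending with a `1`). -/
structure IsASM {n : ℕ} (B : Matrix (Fin n) (Fin n) ℤ) : Prop where
  entries : ∀ i j, B i j ∈ ({-1, 0, 1} : Finset ℤ)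
  row_sum : ∀ i, ∑ j, B i j = 1
  col_sum : ∀ j, ∑ i, B i j = 1
  row_partial : ∀ i k, 0 ≤ ∑ j ∈ Finset.Iic k, B i j ∧ ∑ j ∈ Finset.Iic k, B i j ≤ 1
  col_partial : ∀ j k, 0 ≤ ∑ i ∈ Finset.Iic k, B i j ∧ ∑ i ∈ Finset.Iic k, B i j ≤ 1

theorem finite_setOf_isASM (n : ℕ) : {B : Matrix (Fin n) (Fin n) ℤ | IsASM B}.Finite := by
  have h : (Set.pi Set.univ fun _ : Fin n => Set.pi Set.univ fun _ : Fin n =>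
      ((({-1, 0, 1} : Finset ℤ) : Set ℤ))).Finite :=
    Set.Finite.pi fun _ => Set.Finite.pi fun _ => Finset.finite_toSet _
  exact h.subset fun B hB i _ j _ => hB.entries i j

/-- The finite set of all `n × n` alternating sign matrices. -/
noncomputable def asmFinset (n : ℕ) : Finset (Matrix (Fin n) (Fin n) ℤ) :=
  (finite_setOf_isASM n).toFinset

theorem mem_asmFinset {n : ℕ} (B : Matrix (Fin n) (Fin n) ℤ) :
    B ∈ asmFinset n ↔ IsASM B := by
  simp [asmFinset]

/-- `N(B)`: the number of entries of `B` equal to `-1`. -/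
def asmN {n : ℕ} (B : Matrix (Fin n) (Fin n) ℤ) : ℕ :=
  (Finset.univ.filter fun p : Fin n × Fin n => B p.1 p.2 = -1).card

/-- The inversion number `Inv(B) = ∑_{i < j, k < l} B i l * B j k`. -/
def asmInv {n : ℕ} (B : Matrix (Fin n) (Fin n) ℤ) : ℤ :=
  ∑ i, ∑ k, ∑ j ∈ Finset.Ioi i, ∑ l ∈ Finset.Ioi k, B i l * B j k

/-- For an alternating sign matrix `N(B) ≤ Inv(B)`, so that `Inv(B) - N(B)` is a natural number. -/
theorem IsASM.asmN_le_asmInv {n : ℕ} {B : Matrix (Fin n) (Fin n) ℤ} (hB : IsASM B) :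
    (asmN B : ℤ) ≤ asmInv B := by
  have split : ∀ (f : Fin n → ℤ) (k : Fin n),
      ∑ l, f l = ∑ l ∈ Finset.Iic k, f l + ∑ l ∈ Finset.Ioi k, f l := by
    intro f k
    rw [← Finset.sum_union]
    · congr 1
      ext l
      simp [le_or_gt]
    · rw [Finset.disjoint_left]
      intro l h1 h2
      simp at h1 h2
      exact absurd h1 (not_le.2 h2)
  have split' : ∀ (f : Fin n → ℤ) (k : Fin n),
      ∑ l ∈ Finset.Iic k, f l = f k + ∑ l ∈ Finset.Iio k, f l := by
    intro f k
    rw [← Finset.Iio_insert, Finset.sum_insert (by simp)]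
  have lower : ∀ (f : Fin n → ℤ), (∀ k, 0 ≤ ∑ l ∈ Finset.Iic k, f l ∧
      ∑ l ∈ Finset.Iic k, f l ≤ 1) → ∀ k, ∑ l ∈ Finset.Iio k, f l ≤ 1 := by
    intro f hf k
    rcases Nat.eq_zero_or_pos k.1 with h | h
    · have : Finset.Iio k = ∅ := by
        ext l
        simp only [Finset.mem_Iio, Fin.lt_def, Finset.notMem_empty, iff_false]
        omega
      simp [this]
    · have : Finset.Iio k = Finset.Iic (⟨k.1 - 1, by omega⟩ : Fin n) := by
        ext l
        simp only [Finset.mem_Iio, Finset.mem_Iic, Fin.lt_def, Fin.le_def]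
        omega
      rw [this]
      exact (hf _).2
  have key : ∀ (f : Fin n → ℤ), ∑ l, f l = 1 → (∀ k, 0 ≤ ∑ l ∈ Finset.Iic k, f l ∧
      ∑ l ∈ Finset.Iic k, f l ≤ 1) → ∀ k, 0 ≤ ∑ l ∈ Finset.Ioi k, f l ∧
      (f k = -1 → 1 ≤ ∑ l ∈ Finset.Ioi k, f l) := by
    intro f h1 hf k
    have a := split f k
    have b := split' f k
    have c := lower f hf k
    have d := hf k
    constructor
    · linarith [d.2]
    · intro e
      linarith [d.1]
  have inv_eq : asmInv B = ∑ p : Fin n × Fin n,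
      (∑ l ∈ Finset.Ioi p.2, B p.1 l) * ∑ j ∈ Finset.Ioi p.1, B j p.2 := by
    rw [Fintype.sum_prod_type]
    unfold asmInv
    refine Finset.sum_congr rfl fun i _ => Finset.sum_congr rfl fun k _ => ?_
    rw [Finset.sum_mul_sum, Finset.sum_comm]
  rw [inv_eq, asmN, Finset.card_filter]
  push_cast
  refine Finset.sum_le_sum fun p _ => ?_
  have hr := key (fun l => B p.1 l) (hB.row_sum p.1) (hB.row_partial p.1) p.2
  have hc := key (fun j => B j p.2) (hB.col_sum p.2) (hB.col_partial p.2) p.1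
  split_ifs with h
  · nlinarith [hr.2 h, hc.2 h]
  · exact mul_nonneg hr.1 hc.1

/-- The refined partition function
`Z_ASM^{(n)}(x,y) = ∑_B x ^ N(B) * y ^ (Inv(B) - N(B))` over `n × n` alternating sign matrices. -/
noncomputable def zASM {R : Type*} [CommRing R] (n : ℕ) (x y : R) : R :=
  ∑ B ∈ asmFinset n, x ^ asmN B * y ^ (asmInv B - (asmN B : ℤ)).toNat

/-- The double generating function `f_A(z,w) = ∑_{i,j ≥ 0} A i j z^i w^j` of an infinite matrix;
`z` and `w` are the variables `X 0` and `X 1`. -/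
def doubleGenFun {R : Type*} [CommRing R] (A : Matrix ℕ ℕ R) : MvPowerSeries (Fin 2) R :=
  fun m => A (m 0) (m 1)

theorem coeff_doubleGenFun {R : Type*} [CommRing R] (A : Matrix ℕ ℕ R) (i j : ℕ) :
    MvPowerSeries.coeff (Finsupp.single 0 i + Finsupp.single 1 j) (doubleGenFun A) = A i j := by
  change A _ _ = A i j
  simp

/-- `1 / (1 - z w)` as a formal power series. -/
noncomputable def diagSeries (R : Type*) [CommRing R] : MvPowerSeries (Fin 2) R :=
  MvPowerSeries.invOfUnit (1 - MvPowerSeries.X 0 * MvPowerSeries.X 1) 1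

theorem diagSeries_spec (R : Type*) [CommRing R] :
    (1 - MvPowerSeries.X 0 * MvPowerSeries.X 1) * diagSeries R = 1 :=
  MvPowerSeries.mul_invOfUnit _ _ (by simp)

/-- `1 / (1 - z x - w - (y - x) z w)` as a formal power series. -/
noncomputable def transferSeries {R : Type*} [CommRing R] (x y : R) : MvPowerSeries (Fin 2) R :=
  MvPowerSeries.invOfUnit
    (1 - MvPowerSeries.X 0 * MvPowerSeries.C x - MvPowerSeries.X 1
      - MvPowerSeries.C (y - x) * MvPowerSeries.X 0 * MvPowerSeries.X 1) 1

theorem transferSeries_spec {R : Type*} [CommRing R] (x y : R) :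
    (1 - MvPowerSeries.X 0 * MvPowerSeries.C x - MvPowerSeries.X 1
      - MvPowerSeries.C (y - x) * MvPowerSeries.X 0 * MvPowerSeries.X 1) * transferSeries x y = 1 :=
  MvPowerSeries.mul_invOfUnit _ _ (by simp)

/-- The infinite matrix `G`, whose entry `G i j` is the coefficient of `z^i w^j` in
`1 / (1 - z x - w - (y - x) z w)`. -/
noncomputable def transferMatrix {R : Type*} [CommRing R] (x y : R) : Matrix ℕ ℕ R :=
  Matrix.of fun i j =>
    MvPowerSeries.coeff (Finsupp.single 0 i + Finsupp.single 1 j) (transferSeries x y)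

/-- The infinite matrix `M_ASM = (1 - ν) I + ν G`. -/
noncomputable def mASM {R : Type*} [CommRing R] (x y ν : R) : Matrix ℕ ℕ R :=
  (1 - ν) • (1 : Matrix ℕ ℕ R) + ν • transferMatrix x y

/-- The determinant of the truncation of an infinite matrix to its first `n` rows and columns. -/
def principalMinor {R : Type*} [CommRing R] (A : Matrix ℕ ℕ R) (n : ℕ) : R :=
  (A.submatrix (fun i : Fin n => (i : ℕ)) (fun j : Fin n => (j : ℕ))).det

/-! Alternating sign matrices are the states of a square six-vertex model with domain wall boundary.
The weights in `vertexWeight` deform the problem by row and column parameters z_i, w_j so that the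
Yang-Baxter equation holds; at z = w = 0 a state has weight x^N y^(Inv - N), which gives
`dwPartition_zero_eq_zASM`.

Put a = 1 - zw and b = 1 - xz - w - (y - x)zw. The Izergin-Korepin formula (`izerginKorepin`, stated
without denominators) says that the deformed partition function times the Vandermonde determinants
of z and w is det(1/(ab)) times the product of ab over all (z_i, w_j). The equation for ν makes (1 -
ν)b + νa, the numerator of the generating function of M, factor as g(z)k(w) (`truncEval_mASM`).
Hence that generating function is gk/(ab), and the Izergin determinant is, up to row and column
factors, the determinant of its values at (z_i, w_j). For a truncated matrix this determinant is the
principal minor times the same two Vandermonde determinants (`det_of_truncEval`).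

It remains to cancel the Vandermondes and set z = w = 0, where a = b = g = k = 1. This is done
algebraically in `dwPartition_zero_eq_principalMinor`: with z_i and w_i nilpotent of order i + 1,
truncation loses nothing, and the product of the Vandermondes is a monomial annihilated by every z_i
and w_i but by no nonzero scalar of R. -/

/-- A sum over tuples of length `n + 1` splits off the first coordinate. -/
theorem sum_fin_cons {α M : Type*} [Fintype α] [DecidableEq α] [AddCommMonoid M] {n : ℕ}
    (f : (Fin (n + 1) → α) → M) :
    ∑ t, f t = ∑ u, ∑ t : Fin n → α, f (Fin.cons u t) := by
  rw [← (Fin.consEquiv fun _ : Fin (n + 1) => α).sum_comp, Fintype.sum_prod_type]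
  rfl

/-- An entry of a product of matrices is a sum over paths. -/
theorem list_ofFn_prod_apply {S R : Type*} [Fintype S] [DecidableEq S] [CommRing R] :
    ∀ {m : ℕ} (M : Fin m → Matrix S S R) (s t : S),
      (List.ofFn M).prod s t = ∑ v : Fin (m + 1) → S,
        if v 0 = s ∧ v (Fin.last m) = t then ∏ i : Fin m, M i (v i.castSucc) (v i.succ) else 0
  | 0, M, s, t => by
    rw [sum_fin_cons]
    simp [Matrix.one_apply, ite_and]
  | m + 1, M, s, t => by
    rw [List.ofFn_succ, List.prod_cons, Matrix.mul_apply, sum_fin_cons]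
    simp_rw [list_ofFn_prod_apply (fun i => M i.succ), Fin.prod_univ_succ]
    simp_rw [Finset.mul_sum]
    rw [Finset.sum_comm]
    rw [Finset.sum_comm (s := (Finset.univ : Finset S))
      (t := (Finset.univ : Finset (Fin (m + 1) → S)))]
    refine Finset.sum_congr rfl fun v _ => ?_
    rw [Finset.sum_eq_single (v 0) (by
      intro b _ hb
      simp [hb.symm]) (by simp)]
    rw [Finset.sum_eq_single s (by
      intro b _ hb
      simp [hb]) (by simp)]
    simp [← Fin.succ_last]

/-! ### Six-vertex weights, Yang-Baxter equation and commuting transfer matrices. -/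

section Weights

variable {R : Type*} [CommRing R]

/-- The weights of the six-vertex model: `h`, `v` are the states of the left and upper edges and
`h'`, `v'` those of the right and lower edges of a vertex with spectral parameters `z`, `w`. -/
def vertexWeight (x y z w : R) : Bool → Bool → Bool → Bool → R
  | false, false, false, false => y * (1 - z * w)
  | true, true, true, true => 1 - z * w
  | false, true, false, true => 1 - x * z - w - (y - x) * (z * w)
  | true, false, true, false => 1 - x * z - w - (y - x) * (z * w)
  | false, false, true, true => 1
  | true, true, false, false =>
    (1 - (1 + x - y) * z + x * z ^ 2) * (x - (1 + x - y) * w + w ^ 2)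
  | _, _, _, _ => 0

/-- The matrix of vertex weights with fixed vertical edges. -/
def vertexMatrix (x y z w : R) (v v' : Bool) : Matrix Bool Bool R :=
  Matrix.of fun h h' => vertexWeight x y z w h v h' v'

/-- The monodromy matrix of a row with upper edges `s` and lower edges `s'`. -/
def rowMonodromy (x y z : R) {n : ℕ} (w : Fin n → R) (s s' : Fin n → Bool) :
    Matrix Bool Bool R :=
  (List.ofFn fun j => vertexMatrix x y z (w j) (s j) (s' j)).prod

/-- The row-to-row transfer matrix with left boundary edge `false` and right boundary edge `true`.
-/
def rowTransfer (x y z : R) {n : ℕ} (w : Fin n → R) : Matrix (Fin n → Bool) (Fin n → Bool) R :=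
  Matrix.of fun s s' => rowMonodromy x y z w s s' false true

/-- The partition function with domain wall boundary conditions. -/
def dwPartition (x y : R) {m n : ℕ} (z : Fin m → R) (w : Fin n → R) : R :=
  (List.ofFn fun i => rowTransfer x y (z i) w).prod (fun _ => false) (fun _ => true)

theorem rowMonodromy_cons (x y z : R) {n : ℕ} (w₀ : R) (w : Fin n → R) (v v' : Bool)
    (s s' : Fin n → Bool) :
    rowMonodromy x y z (Fin.cons w₀ w : Fin (n + 1) → R) (Fin.cons v s : Fin (n + 1) → Bool)
      (Fin.cons v' s' : Fin (n + 1) → Bool) =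
      vertexMatrix x y z w₀ v v' * rowMonodromy x y z w s s' := by
  simp [rowMonodromy, List.ofFn_succ]

/-- The two-row column matrix. -/
def columnMatrix (x y z₁ z₂ w : R) (v v' : Bool) : Matrix (Bool × Bool) (Bool × Bool) R :=
  Matrix.of fun a b => ∑ u, vertexMatrix x y z₁ w v u a.1 b.1 * vertexMatrix x y z₂ w u v' a.2 b.2

/-- The two-row monodromy matrix. -/
def doubleMonodromy (x y z₁ z₂ : R) {n : ℕ} (w : Fin n → R) (s s' : Fin n → Bool) :
    Matrix (Bool × Bool) (Bool × Bool) R :=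
  Matrix.of fun a b =>
    ∑ t, rowMonodromy x y z₁ w s t a.1 b.1 * rowMonodromy x y z₂ w t s' a.2 b.2

theorem doubleMonodromy_cons (x y z₁ z₂ : R) {n : ℕ} (w₀ : R) (w : Fin n → R) (v v' : Bool)
    (s s' : Fin n → Bool) :
    doubleMonodromy x y z₁ z₂ (Fin.cons w₀ w : Fin (n + 1) → R)
      (Fin.cons v s : Fin (n + 1) → Bool) (Fin.cons v' s' : Fin (n + 1) → Bool) =
      columnMatrix x y z₁ z₂ w₀ v v' * doubleMonodromy x y z₁ z₂ w s s' := by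
  ext a b
  simp only [doubleMonodromy, Matrix.of_apply, Matrix.mul_apply, sum_fin_cons (α := Bool),
    rowMonodromy_cons, columnMatrix]
  simp only [Fintype.sum_prod_type, Fintype.sum_bool, Finset.mul_sum, ← Finset.sum_add_distrib]
  refine Finset.sum_congr rfl fun t _ => ?_
  ring

/-- The nonzero entries of the `R`-matrix that intertwines two rows. -/
def intertwinerEntry (x y z₁ z₂ : R) : Bool → Bool → Bool → Bool → R
  | false, false, false, false => 1 + (y - x) * z₁ - z₂ + x * (z₁ * z₂)
  | true, true, true, true => 1 + (y - x) * z₁ - z₂ + x * (z₁ * z₂)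
  | false, true, false, true => 1 - (1 + x - y) * z₁ + x * z₁ ^ 2
  | true, false, true, false => 1 - (1 + x - y) * z₂ + x * z₂ ^ 2
  | false, true, true, false => z₁ - z₂
  | true, false, false, true => y * (z₁ - z₂)
  | _, _, _, _ => 0

/-- The `R`-matrix that intertwines two rows. -/
def intertwiner (x y z₁ z₂ : R) : Matrix (Bool × Bool) (Bool × Bool) R :=
  Matrix.of fun a b => intertwinerEntry x y z₁ z₂ a.1 a.2 b.1 b.2

set_option maxHeartbeats 1600000 in
/-- The Yang-Baxter equation. -/
theorem intertwiner_mul_columnMatrix (x y z₁ z₂ w : R) (v v' : Bool) :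
    intertwiner x y z₁ z₂ * columnMatrix x y z₁ z₂ w v v' =
      columnMatrix x y z₂ z₁ w v v' * intertwiner x y z₁ z₂ := by
  ext ⟨a₁, a₂⟩ ⟨b₁, b₂⟩
  simp only [Matrix.mul_apply, Fintype.sum_prod_type, Fintype.sum_bool, intertwiner, columnMatrix,
    vertexMatrix, Matrix.of_apply]
  cases v <;> cases v' <;> cases a₁ <;> cases a₂ <;> cases b₁ <;> cases b₂ <;>
    simp only [intertwinerEntry, vertexWeight, mul_zero, zero_mul, add_zero, zero_add] <;> ring

/-- The train argument: the Yang-Baxter equation pulls the intertwiner through one column at a time.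
-/
theorem intertwiner_mul_doubleMonodromy (x y z₁ z₂ : R) :
    ∀ {n : ℕ} (w : Fin n → R) (s s' : Fin n → Bool),
      intertwiner x y z₁ z₂ * doubleMonodromy x y z₁ z₂ w s s' =
        doubleMonodromy x y z₂ z₁ w s s' * intertwiner x y z₁ z₂
  | 0, w, s, s' => by
    have h : ∀ a b : R, doubleMonodromy x y a b w s s' = 1 := by
      intro a b
      ext i j
      by_cases h₁ : i.1 = j.1 <;>
        simp [doubleMonodromy, rowMonodromy, Matrix.one_apply, Prod.ext_iff, h₁]
    rw [h, h, mul_one, one_mul]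
  | n + 1, w, s, s' => by
    rw [← Fin.cons_self_tail w, ← Fin.cons_self_tail s, ← Fin.cons_self_tail s']
    rw [doubleMonodromy_cons, doubleMonodromy_cons, ← mul_assoc, intertwiner_mul_columnMatrix,
      mul_assoc, intertwiner_mul_doubleMonodromy, mul_assoc]

/-- Both rows have the same boundary states, so the relevant entry of the intertwining relation
involves only the two corner entries of the R-matrix. These are equal, and the nonvanishing
hypothesis allows them to be cancelled. -/
theorem rowTransfer_mul_comm [IsDomain R] (x y z₁ z₂ : R)
    (h : 1 + (y - x) * z₁ - z₂ + x * (z₁ * z₂) ≠ 0) {n : ℕ} (w : Fin n → R) :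
    rowTransfer x y z₁ w * rowTransfer x y z₂ w = rowTransfer x y z₂ w * rowTransfer x y z₁ w := by
  ext s s'
  have e := congrFun (congrFun (intertwiner_mul_doubleMonodromy x y z₁ z₂ w s s') (false, false))
    (true, true)
  simp only [Matrix.mul_apply, Fintype.sum_prod_type, Fintype.sum_bool, intertwiner,
    intertwinerEntry, Matrix.of_apply, zero_mul, mul_zero, zero_add, add_zero] at e
  rw [mul_comm _ (1 + (y - x) * z₁ - z₂ + x * (z₁ * z₂))] at e
  exact mul_left_cancel₀ h e

end Weights

/-! ### Compatibility with ring homomorphisms. -/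

section Maps

variable {R S : Type*} [CommRing R] [CommRing S]

theorem map_vertexWeight (f : R →+* S) (x y z w : R) (h v h' v' : Bool) :
    f (vertexWeight x y z w h v h' v') = vertexWeight (f x) (f y) (f z) (f w) h v h' v' := by
  cases h <;> cases v <;> cases h' <;> cases v' <;> simp [vertexWeight]

theorem map_rowMonodromy (f : R →+* S) (x y z : R) {n : ℕ} (w : Fin n → R) (s s' : Fin n → Bool)
    (h h' : Bool) :
    f (rowMonodromy x y z w s s' h h') =
      rowMonodromy (f x) (f y) (f z) (fun j => f (w j)) s s' h h' := by
  simp [rowMonodromy, list_ofFn_prod_apply, vertexMatrix, map_vertexWeight, apply_ite f]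

theorem map_rowTransfer (f : R →+* S) (x y z : R) {n : ℕ} (w : Fin n → R) (s s' : Fin n → Bool) :
    f (rowTransfer x y z w s s') = rowTransfer (f x) (f y) (f z) (fun j => f (w j)) s s' :=
  map_rowMonodromy f x y z w s s' _ _

theorem map_rowTransfer_prod (f : R →+* S) (x y : R) {m n : ℕ} (z : Fin m → R) (w : Fin n → R)
    (s s' : Fin n → Bool) :
    f ((List.ofFn fun i => rowTransfer x y (z i) w).prod s s') =
      (List.ofFn fun i => rowTransfer (f x) (f y) (f (z i)) (fun j => f (w j))).prod s s' := by
  simp [list_ofFn_prod_apply, map_rowTransfer, apply_ite f]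

theorem map_dwPartition (f : R →+* S) (x y : R) {m n : ℕ} (z : Fin m → R) (w : Fin n → R) :
    f (dwPartition x y z w) = dwPartition (f x) (f y) (fun i => f (z i)) (fun j => f (w j)) :=
  map_rowTransfer_prod f x y z w _ _

end Maps

/-! ### Frozen edges, degree in the first column parameter, row symmetry. -/

section FirstColumn

variable {R : Type*} [CommRing R]

theorem rowTransfer_cons (x y z : R) {n : ℕ} (w₀ : R) (w : Fin n → R) (v v' : Bool)
    (s s' : Fin n → Bool) :
    rowTransfer x y z (Fin.cons w₀ w : Fin (n + 1) → R) (Fin.cons v s : Fin (n + 1) → Bool)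
      (Fin.cons v' s' : Fin (n + 1) → Bool) =
      vertexWeight x y z w₀ false v true v' * rowMonodromy x y z w s s' true true +
      vertexWeight x y z w₀ false v false v' * rowTransfer x y z w s s' := by
  simp [rowTransfer, rowMonodromy_cons, Matrix.mul_apply, vertexMatrix]

theorem const_eq_fin_cons {α : Type*} (n : ℕ) (b : α) :
    (fun _ : Fin (n + 1) => b) = (Fin.cons b fun _ : Fin n => b : Fin (n + 1) → α) := by
  ext i
  refine Fin.cases ?_ (fun i => ?_) i <;> simp

/-- A vertex entered by `true` from the left and `false` from above can only be crossed straight, so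
the whole row is forced. -/
theorem rowMonodromy_false_true_true (x y z : R) :
    ∀ {n : ℕ} (w : Fin n → R) (s' : Fin n → Bool),
      rowMonodromy x y z w (fun _ => false) s' true true =
        if s' = (fun _ => false) then ∏ j, (1 - x * z - w j - (y - x) * (z * w j)) else 0
  | 0, w, s' => by
    simp [rowMonodromy, Subsingleton.elim s' fun _ => false]
  | n + 1, w, s' => by
    have e := const_eq_fin_cons n false
    rw [← Fin.cons_self_tail w, ← Fin.cons_self_tail s', e, rowMonodromy_cons]
    simp only [Fin.cons_inj, Fin.prod_univ_succ, Fin.cons_zero, Fin.cons_succ]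
    generalize s' 0 = v'
    simp only [Matrix.mul_apply, Fintype.sum_bool, vertexMatrix, Matrix.of_apply,
      rowMonodromy_false_true_true]
    cases v' <;> simp [vertexWeight]

/-- Below an edge with state `true`, the first column is frozen. -/
theorem rowTransfer_prod_cons_true (x y w₀ : R) {n : ℕ} (w : Fin n → R) :
    ∀ {m : ℕ} (z : Fin m → R) (s s' : Fin n → Bool),
      (List.ofFn fun i => rowTransfer x y (z i) (Fin.cons w₀ w : Fin (n + 1) → R)).prod
        (Fin.cons true s : Fin (n + 1) → Bool) (Fin.cons true s' : Fin (n + 1) → Bool) =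
        (∏ i, (1 - x * z i - w₀ - (y - x) * (z i * w₀))) *
          (List.ofFn fun i => rowTransfer x y (z i) w).prod s s'
  | 0, z, s, s' => by
    simp [Matrix.one_apply]
  | m + 1, z, s, s' => by
    simp only [List.ofFn_succ, List.prod_cons, Matrix.mul_apply, sum_fin_cons (α := Bool),
      Fintype.sum_bool, rowTransfer_cons, vertexWeight, zero_mul, zero_add, add_zero,
      Finset.sum_const_zero, rowTransfer_prod_cons_true x y w₀ w (fun i => z i.succ),
      Fin.prod_univ_succ, Finset.mul_sum]
    refine Finset.sum_congr rfl fun t _ => ?_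
    ring

/-- The corner vertex has left and upper edges `false`. As 1 - z₀w₀ = 0, it cannot keep them, so it
must turn, with weight 1, and this freezes the rest of the first row and column. -/
theorem dwPartition_cons_of_mul_eq_one (x y : R) {m n : ℕ} (z₀ w₀ : R) (z : Fin m → R)
    (w : Fin n → R) (h : z₀ * w₀ = 1) :
    dwPartition x y (Fin.cons z₀ z : Fin (m + 1) → R) (Fin.cons w₀ w : Fin (n + 1) → R) =
      (∏ j, (1 - x * z₀ - w j - (y - x) * (z₀ * w j))) *
        (∏ i, (1 - x * z i - w₀ - (y - x) * (z i * w₀))) * dwPartition x y z w := by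
  have e := fun b : Bool => const_eq_fin_cons n b
  simp only [dwPartition, List.ofFn_succ, List.prod_cons, Matrix.mul_apply,
    sum_fin_cons (α := Bool), e, Fintype.sum_bool, Fin.cons_zero, Fin.cons_succ, rowTransfer_cons,
    rowTransfer_prod_cons_true, rowMonodromy_false_true_true, vertexWeight, h]
  simp [mul_assoc]

open Polynomial in
theorem mul_mem_degreeLT_succ {p q : R[X]} {m : ℕ} (hp : p.natDegree ≤ 1)
    (hq : q ∈ degreeLT R m) : p * q ∈ degreeLT R (m + 1) := by
  rw [mem_degreeLT] at hq ⊢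
  by_cases h : q = 0
  · simp [h]
  · rw [← natDegree_lt_iff_degree_lt h] at hq
    refine degree_le_natDegree.trans_lt ?_
    have := natDegree_mul_le (p := p) (q := q)
    exact_mod_cast (by omega : (p * q).natDegree < m + 1)

open Polynomial in
-- Left boundary edges are `false`, so the turning weight quadratic in w never occurs in the first
-- column. All its other weights have degree at most 1, and the one vertex where the column passes
-- from `false` to `true` has weight 1; hence the strict bound.
theorem rowTransfer_prod_cons_mem_degreeLT (x y : R) {n : ℕ} (w : Fin n → R) :
    ∀ {m : ℕ} (z : Fin m → R) (s s' : Fin n → Bool),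
      (List.ofFn fun i => rowTransfer (C x) (C y) (C (z i))
        (Fin.cons X (fun j => C (w j)) : Fin (n + 1) → R[X])).prod
        (Fin.cons false s : Fin (n + 1) → Bool) (Fin.cons true s' : Fin (n + 1) → Bool) ∈
        degreeLT R m
  | 0, z, s, s' => by
    simp
  | m + 1, z, s, s' => by
    rw [List.ofFn_succ, List.prod_cons, Matrix.mul_apply, sum_fin_cons (α := Bool),
      Fintype.sum_bool]
    refine add_mem (sum_mem fun t _ => ?_) (sum_mem fun t _ => ?_)
    · rw [rowTransfer_cons, rowTransfer_prod_cons_true, ← map_rowMonodromy,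
        ← map_rowTransfer_prod, mem_degreeLT]
      simp only [vertexWeight, zero_mul, add_zero, one_mul]
      refine lt_of_le_of_lt (b := (m : WithBot ℕ)) ?_ (by exact_mod_cast Nat.lt_succ_self m)
      rw [← natDegree_le_iff_degree_le]
      refine (natDegree_C_mul_le _ _).trans ((natDegree_mul_C_le _ _).trans
        ((natDegree_prod_le _ _).trans ?_))
      refine (Finset.sum_le_card_nsmul _ _ 1 fun i _ => ?_).trans (by simp)
      compute_degree
    · rw [rowTransfer_cons, ← map_rowTransfer]
      have h := rowTransfer_prod_cons_mem_degreeLT x y w (fun i => z i.succ) t s'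
      simp only [vertexWeight, zero_mul, zero_add]
      refine mul_mem_degreeLT_succ ?_ h
      refine (natDegree_mul_C_le _ _).trans ((natDegree_C_mul_le _ _).trans ?_)
      compute_degree

open Polynomial in
theorem natDegree_dwPartition_cons_le (x y : R) {m n : ℕ} (z : Fin (m + 1) → R) (w : Fin n → R) :
    (dwPartition (C x) (C y) (fun i => C (z i))
      (Fin.cons X (fun j => C (w j)) : Fin (n + 1) → R[X])).natDegree ≤ m := by
  have e := fun b : Bool => const_eq_fin_cons n b
  have h := rowTransfer_prod_cons_mem_degreeLT x y w z (fun _ => false) (fun _ => true)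
  rw [← e, ← e, mem_degreeLT] at h
  exact natDegree_le_iff_degree_le.2 (Order.le_of_lt_succ (by exact_mod_cast h))

/-- The partition function is symmetric in the row parameters. -/
theorem dwPartition_comp_perm [IsDomain R] (x y : R) {m n : ℕ} (z : Fin m → R) (w : Fin n → R)
    (hz : ∀ i j, 1 + (y - x) * z i - z j + x * (z i * z j) ≠ 0) (σ : Equiv.Perm (Fin m)) :
    dwPartition x y (z ∘ σ) w = dwPartition x y z w := by
  unfold dwPartition
  have hp := Equiv.Perm.ofFn_comp_perm σ (fun i => rowTransfer x y (z i) w)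
  have := hp.prod_eq' ?_
  · exact congrFun (congrFun this _) _
  · rw [List.pairwise_ofFn]
    exact fun i j _ => rowTransfer_mul_comm x y _ _ (hz _ _) w

end FirstColumn

/-! ### The Izergin-Korepin determinant formula. -/

section IzerginKorepin

variable {R S : Type*} [CommRing R] [CommRing S]

/-- The Izergin-Korepin matrix with cleared denominators. -/
def izerginMatrix (x y : R) {n : ℕ} (z w : Fin n → R) : Matrix (Fin n) (Fin n) R :=
  Matrix.of fun i j => ∏ l ∈ Finset.univ.erase j,
    ((1 - z i * w l) * (1 - x * z i - w l - (y - x) * (z i * w l)))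

theorem map_det_izerginMatrix (f : R →+* S) (x y : R) {n : ℕ} (z w : Fin n → R) :
    f (izerginMatrix x y z w).det =
      (izerginMatrix (f x) (f y) (fun i => f (z i)) (fun j => f (w j))).det := by
  rw [RingHom.map_det]
  congr 1
  ext i j
  simp [izerginMatrix]

theorem map_det_vandermonde (f : R →+* S) {n : ℕ} (z : Fin n → R) :
    f (Matrix.vandermonde z).det = (Matrix.vandermonde fun i => f (z i)).det := by
  simp [Matrix.det_vandermonde]

theorem det_vandermonde_cons {n : ℕ} (z₀ : R) (z : Fin n → R) :
    (Matrix.vandermonde (Fin.cons z₀ z : Fin (n + 1) → R)).det =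
      (∏ i, (z i - z₀)) * (Matrix.vandermonde z).det := by
  rw [Matrix.det_vandermonde, Matrix.det_vandermonde]
  simp [Fin.prod_univ_succ, Fin.prod_Ioi_succ]

theorem det_vandermonde_comp_perm {n : ℕ} (z : Fin n → R) (σ : Equiv.Perm (Fin n)) :
    (Matrix.vandermonde (z ∘ σ)).det = (Equiv.Perm.sign σ : ℤ) * (Matrix.vandermonde z).det := by
  rw [← Matrix.det_permute]
  rfl

theorem det_izerginMatrix_comp_perm (x y : R) {n : ℕ} (z w : Fin n → R)
    (σ : Equiv.Perm (Fin n)) :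
    (izerginMatrix x y (z ∘ σ) w).det =
      (Equiv.Perm.sign σ : ℤ) * (izerginMatrix x y z w).det := by
  rw [← Matrix.det_permute]
  rfl

/-- Columns j and k coincide: the transposition of j and k matches the factors of one product with
those of the other. -/
theorem det_izerginMatrix_eq_zero (x y : R) {n : ℕ} (z w : Fin n → R) {j k : Fin n} (hjk : j ≠ k)
    (h : w j = w k) : (izerginMatrix x y z w).det = 0 := by
  refine Matrix.det_zero_of_column_eq hjk fun i => ?_
  simp only [izerginMatrix, Matrix.of_apply]
  refine Finset.prod_bij' (fun l _ => Equiv.swap j k l) (fun l _ => Equiv.swap j k l) ?_ ?_ ?_ ?_ ?_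
  · intro l hl
    simp only [Finset.mem_erase, Finset.mem_univ, and_true] at hl ⊢
    intro e
    exact hl (by simpa using (Equiv.swap j k).injective (e.trans (Equiv.swap_apply_left j k).symm))
  · intro l hl
    simp only [Finset.mem_erase, Finset.mem_univ, and_true] at hl ⊢
    intro e
    exact hl (by simpa using (Equiv.swap j k).injective (e.trans (Equiv.swap_apply_right j k).symm))
  · simp
  · simp
  · intro l _
    have : w (Equiv.swap j k l) = w l := by
      by_cases h1 : l = j
      · simp [h1, h]
      · by_cases h2 : l = k
        · simp [h2, h]
        · rw [Equiv.swap_apply_of_ne_of_ne h1 h2]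
    rw [this]

theorem univ_erase_zero_prod {n : ℕ} (f : Fin (n + 1) → R) :
    ∏ l ∈ Finset.univ.erase 0, f l = ∏ l : Fin n, f l.succ := by
  refine Eq.trans ?_ (Finset.prod_map Finset.univ (Fin.succEmb n) f)
  congr 1
  ext l
  refine Fin.cases ?_ (fun l => ?_) l <;> simp

theorem univ_erase_succ_prod {n : ℕ} (f : Fin (n + 1) → R) (j : Fin n) :
    ∏ l ∈ Finset.univ.erase j.succ, f l = f 0 * ∏ l ∈ Finset.univ.erase j, f l.succ := by
  have e : ∏ l ∈ Finset.univ.erase j, f l.succ =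
      ∏ l ∈ (Finset.univ.erase j).map (Fin.succEmb n), f l :=
    (Finset.prod_map (Finset.univ.erase j) (Fin.succEmb n) f).symm
  rw [e, ← Finset.prod_insert (by simp)]
  congr 1
  ext l
  refine Fin.cases ?_ (fun l => ?_) l
  · simp [(Fin.succ_ne_zero j).symm]
  · simp

theorem det_izerginMatrix_cons_of_mul_eq_one (x y : R) {n : ℕ} (z₀ w₀ : R) (z w : Fin n → R)
    (h : z₀ * w₀ = 1) :
    (izerginMatrix x y (Fin.cons z₀ z : Fin (n + 1) → R) (Fin.cons w₀ w : Fin (n + 1) → R)).det =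
      (∏ l, ((1 - z₀ * w l) * (1 - x * z₀ - w l - (y - x) * (z₀ * w l)))) *
      ((∏ i, ((1 - z i * w₀) * (1 - x * z i - w₀ - (y - x) * (z i * w₀)))) *
        (izerginMatrix x y z w).det) := by
  -- In row 0 every entry off the corner contains the vanishing factor 1 - z₀w₀, so the expansion
  -- has one term.
  rw [Matrix.det_succ_row_zero, Fin.sum_univ_succ, Finset.sum_eq_zero (s := Finset.univ)
    (fun j _ => by simp [izerginMatrix, univ_erase_succ_prod, h]), ← Matrix.det_mul_column]
  rw [add_zero]
  congr 1
  · simp [izerginMatrix, univ_erase_zero_prod]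
  · congr 1
    ext i j
    simp [izerginMatrix, univ_erase_succ_prod]

/-- The Izergin-Korepin identity. -/
def IzerginKorepin (x y : R) {n : ℕ} (z w : Fin n → R) : Prop :=
  dwPartition x y z w * (Matrix.vandermonde z).det * (Matrix.vandermonde w).det =
    (izerginMatrix x y z w).det

theorem IzerginKorepin.cons {x y : R} {n : ℕ} {z₀ w₀ : R} {z w : Fin n → R} (h : z₀ * w₀ = 1)
    (hi : IzerginKorepin x y z w) :
    IzerginKorepin x y (Fin.cons z₀ z : Fin (n + 1) → R) (Fin.cons w₀ w : Fin (n + 1) → R) := by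
  unfold IzerginKorepin at hi ⊢
  rw [det_izerginMatrix_cons_of_mul_eq_one x y z₀ w₀ z w h,
    dwPartition_cons_of_mul_eq_one x y z₀ w₀ z w h, det_vandermonde_cons, det_vandermonde_cons,
    ← hi, Finset.prod_mul_distrib, Finset.prod_mul_distrib]
  -- Given z₀w₀ = 1, the identity (1 - z₀w)(1 - zw₀) = (z - z₀)(w - w₀) turns the extra a-factors
  -- into the extra Vandermonde factors.
  have e : (∏ j, (1 - z₀ * w j)) * ∏ i, (1 - z i * w₀) =
      (∏ i, (z i - z₀)) * ∏ j, (w j - w₀) := by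
    rw [← Finset.prod_mul_distrib, ← Finset.prod_mul_distrib]
    refine Finset.prod_congr rfl fun i _ => ?_
    linear_combination (z i * w i - 1) * h
  linear_combination (-((∏ j, (1 - x * z₀ - w j - (y - x) * (z₀ * w j))) *
        (∏ i, (1 - x * z i - w₀ - (y - x) * (z i * w₀))) * dwPartition x y z w *
        (Matrix.vandermonde z).det * (Matrix.vandermonde w).det)) * e

open Polynomial in
-- Column 0 omits the factor l = 0 and is constant in `X`; in each of the n other columns only that
-- factor, of degree at most 2, involves `X`.
theorem natDegree_det_izerginMatrix_cons_le (x y : R) {n : ℕ} (z : Fin (n + 1) → R)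
    (w : Fin n → R) :
    (izerginMatrix (C x) (C y) (fun i => C (z i))
      (Fin.cons X (fun j => C (w j)) : Fin (n + 1) → R[X])).det.natDegree ≤ 2 * n := by
  rw [Matrix.det_apply]
  refine natDegree_sum_le_of_forall_le _ _ fun σ _ => ?_
  refine (natDegree_smul_le _ _).trans ((natDegree_prod_le _ _).trans ?_)
  rw [Fin.sum_univ_succ]
  have h0 : ∀ i, (izerginMatrix (C x) (C y) (fun i => C (z i))
      (Fin.cons X (fun j => C (w j)) : Fin (n + 1) → R[X]) i 0).natDegree = 0 := by
    intro i
    simp only [izerginMatrix, Matrix.of_apply, univ_erase_zero_prod, Fin.cons_succ, ← C_mul,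
      ← C_sub, ← C_1, ← map_prod, natDegree_C]
  have h1 : ∀ i (j : Fin n), (izerginMatrix (C x) (C y) (fun i => C (z i))
      (Fin.cons X (fun j => C (w j)) : Fin (n + 1) → R[X]) i j.succ).natDegree ≤ 2 := by
    intro i j
    simp only [izerginMatrix, Matrix.of_apply, univ_erase_succ_prod, Fin.cons_succ, ← C_mul,
      ← C_sub, ← C_1, ← map_prod]
    refine (natDegree_mul_C_le _ _).trans ?_
    simp only [Fin.cons_zero]
    compute_degree
  rw [h0, zero_add]
  refine (Finset.sum_le_card_nsmul _ _ 2 fun i _ => h1 _ _).trans ?_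
  simp [mul_comm]

open Polynomial in
theorem natDegree_det_vandermonde_cons_le {n : ℕ} (w : Fin n → R) :
    (Matrix.vandermonde (Fin.cons X (fun j => C (w j)) : Fin (n + 1) → R[X])).det.natDegree
      ≤ n := by
  rw [det_vandermonde_cons, ← map_det_vandermonde]
  refine (natDegree_mul_C_le _ _).trans ((natDegree_prod_le _ _).trans
    ((Finset.sum_le_card_nsmul _ _ 1 fun i _ => ?_).trans (by simp)))
  compute_degree

open Polynomial in
/-- The Izergin-Korepin identity for generic parameters in a field. -/
theorem izerginKorepin_of_generic {K : Type*} [Field K] (x y : K) :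
    ∀ {n : ℕ} (z w : Fin n → K), z.Injective → (∀ i, z i ≠ 0) → w.Injective →
      (∀ i j, z i * w j ≠ 1) → (∀ i j, 1 + (y - x) * z i - z j + x * (z i * z j) ≠ 0) →
      IzerginKorepin x y z w
  | 0, z, w, _, _, _, _, _ => by
    simp [IzerginKorepin, dwPartition, Matrix.one_apply, funext_iff]
  | n + 1, z, w, hz, hz0, hw, hzw, hr => by
    set w' : Fin n → K := Fin.tail w with hw'
    have hw'i : w'.Injective := hw.comp (Fin.succ_injective n)
    -- The difference of the two sides as a polynomial in the first column parameter.
    set F : K[X] := dwPartition (C x) (C y) (fun i => C (z i))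
        (Fin.cons X (fun j => C (w' j)) : Fin (n + 1) → K[X]) *
        (Matrix.vandermonde fun i => C (z i)).det *
        (Matrix.vandermonde (Fin.cons X (fun j => C (w' j)) : Fin (n + 1) → K[X])).det -
        (izerginMatrix (C x) (C y) (fun i => C (z i))
          (Fin.cons X (fun j => C (w' j)) : Fin (n + 1) → K[X])).det with hF
    have hev : ∀ a : K, F.eval a = dwPartition x y z (Fin.cons a w' : Fin (n + 1) → K) *
        (Matrix.vandermonde z).det * (Matrix.vandermonde (Fin.cons a w' : Fin (n + 1) → K)).det -
        (izerginMatrix x y z (Fin.cons a w' : Fin (n + 1) → K)).det := by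
      intro a
      have e : (fun j => evalRingHom a ((Fin.cons X (fun j => C (w' j)) : Fin (n + 1) → K[X]) j)) =
          (Fin.cons a w' : Fin (n + 1) → K) := by
        ext j
        refine Fin.cases ?_ (fun j => ?_) j <;> simp
      rw [← coe_evalRingHom, hF, map_sub, map_mul, map_mul, map_dwPartition, map_det_vandermonde,
        map_det_vandermonde, map_det_izerginMatrix, e]
      simp
    have hdeg : F.natDegree ≤ 2 * n := by
      refine (natDegree_sub_le _ _).trans (max_le ?_ (natDegree_det_izerginMatrix_cons_le x y z w'))
      refine natDegree_mul_le.trans ?_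
      have h1 := natDegree_dwPartition_cons_le x y z w'
      have h2 := natDegree_det_vandermonde_cons_le w'
      rw [← map_det_vandermonde]
      have h3 := (natDegree_mul_C_le (dwPartition (C x) (C y) (fun i => C (z i))
        (Fin.cons X (fun j => C (w' j)) : Fin (n + 1) → K[X])) (Matrix.vandermonde z).det).trans h1
      omega
    have hF0 : F = 0 := by
      -- Degree at most 2n against 2n + 1 distinct roots: the n + 1 inverses of the z_i and the n
      -- remaining w_j.
      refine eq_zero_of_natDegree_lt_card_of_eval_eq_zero F
        (f := (Sum.elim (fun i => (z i)⁻¹) w' : Fin (n + 1) ⊕ Fin n → K)) ?_ ?_ ?_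
      · refine Function.Injective.sumElim (fun i j h => hz (inv_injective h)) hw'i fun i j h => ?_
        exact hzw i j.succ (by
          have : w j.succ = (z i)⁻¹ := h.symm
          rw [this, mul_inv_cancel₀ (hz0 i)])
      · rintro (i | j)
        · rw [hev, sub_eq_zero]
          -- Row symmetry moves z_i to the first row, where the recursion at z₀w₀ = 1 and the
          -- induction hypothesis apply. The Vandermonde and Izergin determinants acquire the same
          -- sign.
          have hp : IzerginKorepin x y (z ∘ Equiv.swap 0 i)
              (Fin.cons (z i)⁻¹ w' : Fin (n + 1) → K) := by
            set z' := z ∘ Equiv.swap 0 i with hz'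
            have hz'i : z'.Injective := hz.comp (Equiv.injective _)
            rw [← Fin.cons_self_tail z']
            refine IzerginKorepin.cons (by simp [hz', hz0]) ?_
            exact izerginKorepin_of_generic x y _ _ (hz'i.comp (Fin.succ_injective n))
              (fun _ => hz0 _) hw'i (fun _ _ => hzw _ _) fun _ _ => hr _ _
          unfold IzerginKorepin at hp
          rw [dwPartition_comp_perm x y z _ hr, det_vandermonde_comp_perm,
            det_izerginMatrix_comp_perm] at hp
          have hs : ((Equiv.Perm.sign (Equiv.swap 0 i) : ℤ) : K) ≠ 0 := by
            rcases Int.units_eq_one_or (Equiv.Perm.sign (Equiv.swap 0 i)) with h | h <;> simp [h]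
          refine mul_left_cancel₀ hs ?_
          rw [Sum.elim_inl, ← hp]
          ring
        · rw [hev, det_izerginMatrix_eq_zero x y z _ (Fin.succ_ne_zero j) (by simp)]
          have : (Matrix.vandermonde (Fin.cons (w' j) w' : Fin (n + 1) → K)).det = 0 :=
            Matrix.det_zero_of_row_eq (Fin.succ_ne_zero j) (by ext k; simp [Matrix.vandermonde])
          rw [Sum.elim_inr, this, mul_zero, sub_zero]
      · simp only [Fintype.card_sum, Fintype.card_fin]
        omega
    have := hev (w 0)
    rw [hF0, eval_zero, hw', Fin.cons_self_tail] at this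
    exact (sub_eq_zero.1 this.symm)

/-- The Izergin-Korepin identity in an arbitrary commutative ring. -/
theorem izerginKorepin (x y : R) {n : ℕ} (z w : Fin n → R) : IzerginKorepin x y z w := by
  -- The identity is proved for independent variables x, y, z_i, w_j over ℤ and then specialized.
  let σ := Fin 2 ⊕ (Fin n ⊕ Fin n)
  let A := MvPolynomial σ ℤ
  let X : σ → A := MvPolynomial.X
  have hX : Function.Injective X := MvPolynomial.X_injective
  let K := FractionRing A
  have hinj : Function.Injective (algebraMap A K) := IsFractionRing.injective A K
  have hA : IzerginKorepin (X (.inl 0)) (X (.inl 1)) (fun i => X (.inr (.inl i)))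
      (fun i => X (.inr (.inr i))) := by
    refine hinj ?_
    rw [map_mul, map_mul, map_dwPartition, map_det_vandermonde, map_det_vandermonde,
      map_det_izerginMatrix]
    -- The last two genericity conditions concern polynomials with constant term -1 and 1.
    have c0 : ∀ p : A, MvPolynomial.constantCoeff p ≠ 0 → algebraMap A K p ≠ 0 := by
      intro p hp h0
      rw [(map_eq_zero_iff _ hinj).1 h0, map_zero] at hp
      exact hp rfl
    refine izerginKorepin_of_generic _ _ _ _ ?_ ?_ ?_ ?_ ?_
    · intro i j h
      exact Sum.inl_injective (Sum.inr_injective (hX (hinj h)))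
    · intro i h
      exact MvPolynomial.X_ne_zero _ ((map_eq_zero_iff _ hinj).1 h)
    · intro i j h
      exact Sum.inr_injective (Sum.inr_injective (hX (hinj h)))
    · intro i j h
      have := c0 (X (.inr (.inl i)) * X (.inr (.inr j)) - 1) (by simp [X])
      rw [map_sub, map_mul, map_one] at this
      exact this (sub_eq_zero.2 h)
    · intro i j
      have := c0 (1 + (X (.inl 1) - X (.inl 0)) * X (.inr (.inl i)) - X (.inr (.inl j)) +
        X (.inl 0) * (X (.inr (.inl i)) * X (.inr (.inl j)))) (by simp [X])
      simpa only [map_add, map_sub, map_mul, map_one] using this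
  let f : A →+* R := MvPolynomial.eval₂Hom (Int.castRingHom R)
    (Sum.elim ![x, y] (Sum.elim z w))
  have h := congrArg f hA
  rw [map_mul, map_mul, map_dwPartition, map_det_vandermonde, map_det_vandermonde,
      map_det_izerginMatrix] at h
  simpa [f, X, A, IzerginKorepin] using h

end IzerginKorepin

/-! ### Generating functions, formal and evaluated at nilpotent points. -/

section GeneratingFunctions

variable {R : Type*} [CommRing R]

/-- The matrix `A` with a row of zeros put on top. -/
def shiftRow (A : Matrix ℕ ℕ R) : Matrix ℕ ℕ R :=
  Matrix.of fun i j => if i = 0 then 0 else A (i - 1) j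

/-- The matrix `A` with a column of zeros put on the left. -/
def shiftCol (A : Matrix ℕ ℕ R) : Matrix ℕ ℕ R :=
  Matrix.of fun i j => if j = 0 then 0 else A i (j - 1)

theorem coeff_doubleGenFun' (A : Matrix ℕ ℕ R) (m : Fin 2 →₀ ℕ) :
    MvPowerSeries.coeff m (doubleGenFun A) = A (m 0) (m 1) := rfl

theorem doubleGenFun_injective : Function.Injective (doubleGenFun (R := R)) := by
  intro A B h
  ext i j
  rw [← coeff_doubleGenFun A i j, h, coeff_doubleGenFun]

theorem doubleGenFun_add (A B : Matrix ℕ ℕ R) :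
    doubleGenFun (A + B) = doubleGenFun A + doubleGenFun B := rfl

theorem doubleGenFun_sub (A B : Matrix ℕ ℕ R) :
    doubleGenFun (A - B) = doubleGenFun A - doubleGenFun B := rfl

theorem doubleGenFun_smul (c : R) (A : Matrix ℕ ℕ R) :
    doubleGenFun (c • A) = MvPowerSeries.C c * doubleGenFun A := by
  ext m
  rw [MvPowerSeries.coeff_C_mul]
  rfl

theorem X_zero_mul_doubleGenFun (A : Matrix ℕ ℕ R) :
    MvPowerSeries.X 0 * doubleGenFun A = doubleGenFun (shiftRow A) := by
  ext m
  rw [MvPowerSeries.X, MvPowerSeries.coeff_monomial_mul]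
  by_cases h : m 0 = 0
  · rw [if_neg (by simp [h])]
    simp [h, coeff_doubleGenFun', shiftRow]
  · rw [if_pos (Finsupp.single_le_iff.2 (Nat.one_le_iff_ne_zero.2 h))]
    simp [h, coeff_doubleGenFun', shiftRow]

theorem X_one_mul_doubleGenFun (A : Matrix ℕ ℕ R) :
    MvPowerSeries.X 1 * doubleGenFun A = doubleGenFun (shiftCol A) := by
  ext m
  rw [MvPowerSeries.X, MvPowerSeries.coeff_monomial_mul]
  by_cases h : m 1 = 0
  · rw [if_neg (by simp [h])]
    simp [h, coeff_doubleGenFun', shiftCol]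
  · rw [if_pos (Finsupp.single_le_iff.2 (Nat.one_le_iff_ne_zero.2 h))]
    simp [h, coeff_doubleGenFun', shiftCol]

/-- The matrix whose generating function is `1`. -/
def cornerMatrix (R : Type*) [CommRing R] : Matrix ℕ ℕ R :=
  Matrix.of fun i j => if i = 0 ∧ j = 0 then 1 else 0

theorem doubleGenFun_cornerMatrix : doubleGenFun (cornerMatrix R) = 1 := by
  ext m
  rw [coeff_doubleGenFun', MvPowerSeries.coeff_one]
  simp [cornerMatrix, Finsupp.ext_iff, Fin.forall_fin_two]

theorem doubleGenFun_one : doubleGenFun (1 : Matrix ℕ ℕ R) = diagSeries R := by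
  have h : (1 - MvPowerSeries.X 0 * MvPowerSeries.X 1) * doubleGenFun (1 : Matrix ℕ ℕ R) = 1 := by
    rw [sub_mul, one_mul, mul_assoc, X_one_mul_doubleGenFun, X_zero_mul_doubleGenFun,
      ← doubleGenFun_sub, ← doubleGenFun_cornerMatrix]
    congr 1
    ext i j
    rcases i with _ | i <;> rcases j with _ | j <;>
      simp [shiftRow, shiftCol, cornerMatrix, Matrix.one_apply]
  calc _ = doubleGenFun (1 : Matrix ℕ ℕ R) *
        ((1 - MvPowerSeries.X 0 * MvPowerSeries.X 1) * diagSeries R) := by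
        rw [diagSeries_spec, mul_one]
    _ = ((1 - MvPowerSeries.X 0 * MvPowerSeries.X 1) * doubleGenFun (1 : Matrix ℕ ℕ R)) *
        diagSeries R := by ring
    _ = _ := by rw [h, one_mul]

theorem doubleGenFun_transferMatrix (x y : R) :
    doubleGenFun (transferMatrix x y) = transferSeries x y := by
  ext m
  have e : Finsupp.single 0 (m 0) + Finsupp.single 1 (m 1) = m := by
    ext k
    fin_cases k <;> simp
  rw [coeff_doubleGenFun', transferMatrix, Matrix.of_apply, e]

theorem doubleGenFun_mASM (x y ν : R) :
    doubleGenFun (mASM x y ν) =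
      MvPowerSeries.C (1 - ν) * diagSeries R + MvPowerSeries.C ν * transferSeries x y := by
  rw [mASM, doubleGenFun_add, doubleGenFun_smul, doubleGenFun_smul, doubleGenFun_one,
    doubleGenFun_transferMatrix]

/-- This is the denominator of the series read coefficientwise, a form that survives truncation at
nilpotent points. -/
theorem transferMatrix_recurrence (x y : R) :
    transferMatrix x y = cornerMatrix R + x • shiftRow (transferMatrix x y) +
      shiftCol (transferMatrix x y) + (y - x) • shiftRow (shiftCol (transferMatrix x y)) := by
  refine doubleGenFun_injective ?_
  have h := transferSeries_spec x y
  simp only [doubleGenFun_add, doubleGenFun_smul, ← X_zero_mul_doubleGenFun,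
    ← X_one_mul_doubleGenFun, doubleGenFun_cornerMatrix, doubleGenFun_transferMatrix]
  linear_combination h

/-- The generating function of a truncated matrix. -/
def truncEval {S : Type*} [CommRing S] [Algebra R S] (A : Matrix ℕ ℕ R) (n : ℕ) (z w : S) : S :=
  ∑ i ∈ Finset.range n, ∑ j ∈ Finset.range n, algebraMap R S (A i j) * z ^ i * w ^ j

section TruncEval

variable {S : Type*} [CommRing S] [Algebra R S]

theorem truncEval_add (A B : Matrix ℕ ℕ R) (n : ℕ) (z w : S) :
    truncEval (A + B) n z w = truncEval A n z w + truncEval B n z w := by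
  simp [truncEval, add_mul, Finset.sum_add_distrib]

theorem truncEval_smul (c : R) (A : Matrix ℕ ℕ R) (n : ℕ) (z w : S) :
    truncEval (c • A) n z w = algebraMap R S c * truncEval A n z w := by
  simp [truncEval, mul_assoc, Finset.mul_sum]

theorem sum_range_shift (n : ℕ) (c : ℕ → S) (t : S) (ht : t ^ n = 0) :
    ∑ i ∈ Finset.range n, (if i = 0 then 0 else c (i - 1)) * t ^ i =
      t * ∑ i ∈ Finset.range n, c i * t ^ i := by
  cases n with
  | zero => simp
  | succ n =>
    rw [Finset.sum_range_succ', Finset.sum_range_succ, mul_add, Finset.mul_sum]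
    -- The top term, which the shift pushes out of range, is killed by nilpotency.
    have e : t * (c n * t ^ n) = 0 := by
      rw [show t * (c n * t ^ n) = c n * t ^ (n + 1) by ring, ht, mul_zero]
    rw [e]
    simp only [Nat.add_eq_zero_iff, one_ne_zero, and_false, if_false, Nat.add_sub_cancel, if_true,
      zero_mul]
    congr 1
    exact Finset.sum_congr rfl fun i _ => by ring

theorem truncEval_shiftRow (A : Matrix ℕ ℕ R) (n : ℕ) (z w : S) (hz : z ^ n = 0) :
    truncEval (shiftRow A) n z w = z * truncEval A n z w := by
  have h := sum_range_shift n
    (fun i => ∑ j ∈ Finset.range n, algebraMap R S (A i j) * w ^ j) z hz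
  have e : ∀ B : Matrix ℕ ℕ R, truncEval B n z w =
      ∑ i ∈ Finset.range n, (∑ j ∈ Finset.range n, algebraMap R S (B i j) * w ^ j) * z ^ i := by
    intro B
    simp only [truncEval, Finset.sum_mul]
    exact Finset.sum_congr rfl fun i _ => Finset.sum_congr rfl fun j _ => by ring
  rw [e, e, ← h]
  refine Finset.sum_congr rfl fun i _ => ?_
  split_ifs with h0 <;> simp [shiftRow, h0]

theorem truncEval_shiftCol (A : Matrix ℕ ℕ R) (n : ℕ) (z w : S) (hw : w ^ n = 0) :
    truncEval (shiftCol A) n z w = w * truncEval A n z w := by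
  simp only [truncEval, Finset.mul_sum (s := Finset.range n)]
  refine Finset.sum_congr rfl fun i _ => ?_
  have h := sum_range_shift n (fun j => algebraMap R S (A i j) * z ^ i) w hw
  rw [Finset.mul_sum] at h
  rw [← h]
  refine Finset.sum_congr rfl fun j _ => ?_
  split_ifs with h0 <;> simp [shiftCol, h0]

theorem truncEval_cornerMatrix (n : ℕ) (z w : S) (hz : z ^ n = 0) :
    truncEval (cornerMatrix R) n z w = 1 := by
  cases n with
  | zero => simpa [truncEval] using hz.symm
  | succ n => simp [truncEval, cornerMatrix, Finset.sum_range_succ']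

theorem truncEval_one (n : ℕ) (z w : S) (hz : z ^ n = 0) :
    (1 - z * w) * truncEval (1 : Matrix ℕ ℕ R) n z w = 1 := by
  have e : truncEval (1 : Matrix ℕ ℕ R) n z w = ∑ i ∈ Finset.range n, (z * w) ^ i := by
    refine Finset.sum_congr rfl fun i hi => ?_
    rw [Finset.sum_eq_single_of_mem i hi fun j _ hj => by simp [hj.symm]]
    simp [mul_pow]
  rw [e, mul_neg_geom_sum, mul_pow, hz, zero_mul, sub_zero]

theorem truncEval_transferMatrix (x y : R) (n : ℕ) (z w : S) (hz : z ^ n = 0) (hw : w ^ n = 0) :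
    (1 - algebraMap R S x * z - w - (algebraMap R S y - algebraMap R S x) * (z * w)) *
      truncEval (transferMatrix x y) n z w = 1 := by
  have h := congrArg (fun A => truncEval A n z w) (transferMatrix_recurrence x y)
  simp only [truncEval_add, truncEval_smul, truncEval_shiftRow _ n z w hz,
    truncEval_shiftCol _ n z w hw, truncEval_cornerMatrix n z w hz, map_sub] at h
  linear_combination h

/-- The only place where the equation for ν enters: it matches the zw coefficient of (1 - ν)b + νa
with that of the factored right-hand side; the other coefficients agree identically. -/
theorem truncEval_mASM (x y ν : R) (hν : x * ν * (1 - ν) = ν + y * (1 - ν)) (n : ℕ) (z w : S)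
    (hz : z ^ n = 0) (hw : w ^ n = 0) :
    (1 - z * w) *
      (1 - algebraMap R S x * z - w - (algebraMap R S y - algebraMap R S x) * (z * w)) *
      truncEval (mASM x y ν) n z w =
      (1 - algebraMap R S ((1 - ν) * x) * z) * (1 - algebraMap R S (1 - ν) * w) := by
  rw [mASM, truncEval_add, truncEval_smul, truncEval_smul]
  have h1 := truncEval_one (R := R) n z w hz
  have h2 := truncEval_transferMatrix x y n z w hz hw
  have h3 := congrArg (algebraMap R S) hν
  simp only [map_mul, map_sub, map_add, map_one] at h3 ⊢
  generalize algebraMap R S x = x at *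
  generalize algebraMap R S y = y at *
  generalize algebraMap R S ν = ν at *
  linear_combination (1 - ν) * (1 - x * z - w - (y - x) * (z * w)) * h1 +
    ν * (1 - z * w) * h2 + z * w * h3

/-- A truncated generating function evaluated at families of points factors through the
Vandermonde matrices. -/
theorem det_of_truncEval (A : Matrix ℕ ℕ R) (n : ℕ) (z w : Fin n → S) :
    (Matrix.of fun i j => truncEval A n (z i) (w j)).det =
      (Matrix.vandermonde z).det * (Matrix.vandermonde w).det *
        algebraMap R S (principalMinor A n) := by
  have e : (Matrix.of fun i j => truncEval A n (z i) (w j)) =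
      Matrix.vandermonde z *
        (algebraMap R S).mapMatrix
          (A.submatrix (fun i : Fin n => (i : ℕ)) fun j : Fin n => (j : ℕ)) *
        (Matrix.vandermonde w)ᵀ := by
    ext i j
    simp only [truncEval, Matrix.mul_apply, Matrix.of_apply, Finset.sum_range, Finset.sum_mul,
      Matrix.vandermonde_apply, Matrix.transpose_apply, RingHom.mapMatrix_apply, Matrix.map_apply,
      Matrix.submatrix_apply]
    rw [Finset.sum_comm]
    exact Finset.sum_congr rfl fun a _ => Finset.sum_congr rfl fun b _ => by ring
  rw [e, Matrix.det_mul, Matrix.det_mul, Matrix.det_transpose, ← RingHom.map_det, principalMinor]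
  ring

end TruncEval

end GeneratingFunctions

/-! ### The homogeneous limit by nilpotent specialization. -/

section Specialization

/-- A universal algebra with nilpotent elements `t k` of order `e k + 1`. -/
theorem exists_nilpotent_algebra.{u} {R : Type u} [CommRing R] {σ : Type} [Fintype σ] (e : σ → ℕ) :
    ∃ (S : Type u) (_ : CommRing S) (_ : Algebra R S) (t : σ → S),
      (∀ k, t k ^ (e k + 1) = 0) ∧
        ∀ r : R, algebraMap R S r * ∏ k, t k ^ e k = 0 → r = 0 := by
  classical
  let I : Ideal (MvPolynomial σ R) := Ideal.span
    ((fun s => MvPolynomial.monomial s (1 : R)) '' Set.range fun k => Finsupp.single k (e k + 1))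
  refine ⟨MvPolynomial σ R ⧸ I, inferInstance, inferInstance,
    fun k => Ideal.Quotient.mk I (MvPolynomial.X k), fun k => ?_, fun r hr => ?_⟩
  · rw [← map_pow, Ideal.Quotient.eq_zero_iff_mem]
    refine Ideal.subset_span ⟨_, ⟨k, rfl⟩, ?_⟩
    rw [MvPolynomial.X_pow_eq_monomial]
  · have h : Ideal.Quotient.mk I (MvPolynomial.C r * ∏ k, MvPolynomial.X k ^ e k) = 0 := by
      rw [map_mul, map_prod]
      simp only [map_pow]
      exact hr
    have hm : MvPolynomial.C r * ∏ k, MvPolynomial.X k ^ e k =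
        MvPolynomial.monomial (Finsupp.equivFunOnFinite.symm e) r := by
      rw [MvPolynomial.monomial_eq, Finsupp.prod_fintype _ _ (by simp)]
      simp
    rw [hm, Ideal.Quotient.eq_zero_iff_mem, MvPolynomial.mem_ideal_span_monomial_image] at h
    by_contra h0
    obtain ⟨_, ⟨k, rfl⟩, hk⟩ := h (Finsupp.equivFunOnFinite.symm e) (by
      simp [MvPolynomial.coeff_monomial, h0])
    -- Membership in the monomial ideal would force e k + 1 ≤ e k.
    have := hk k
    simp at this

/-- Entries z_i^j with j > i vanish, so the matrix is triangular. -/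
theorem det_vandermonde_of_pow_eq_zero {S : Type*} [CommRing S] {n : ℕ} (z : Fin n → S)
    (hz : ∀ i : Fin n, z i ^ ((i : ℕ) + 1) = 0) :
    (Matrix.vandermonde z).det = ∏ i, z i ^ (i : ℕ) := by
  rw [Matrix.det_of_isLowerTriangular]
  · simp [Matrix.vandermonde_apply]
  · intro i j hij
    exact pow_eq_zero_of_le (Nat.succ_le_of_lt hij) (hz i)

theorem mul_prod_pow_eq_zero {S : Type*} [CommRing S] {n : ℕ} (z : Fin n → S)
    (hz : ∀ i : Fin n, z i ^ ((i : ℕ) + 1) = 0) (k : Fin n) : z k * ∏ i, z i ^ (i : ℕ) = 0 := by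
  rw [← Finset.mul_prod_erase _ _ (Finset.mem_univ k), ← mul_assoc, ← pow_succ', hz, zero_mul]

theorem dwPartition_zero_eq_principalMinor {R : Type*} [CommRing R] (x y ν : R)
    (hν : x * ν * (1 - ν) = ν + y * (1 - ν)) (n : ℕ) :
    dwPartition x y (fun _ : Fin n => 0) (fun _ : Fin n => 0) =
      principalMinor (mASM x y ν) n := by
  obtain ⟨S, _, _, t, ht, hinj⟩ := exists_nilpotent_algebra (R := R)
    (Sum.elim (fun i : Fin n => (i : ℕ)) (fun i : Fin n => (i : ℕ)))
  set z : Fin n → S := fun i => t (.inl i) with hzdef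
  set w : Fin n → S := fun i => t (.inr i) with hwdef
  have hz : ∀ i : Fin n, z i ^ ((i : ℕ) + 1) = 0 := fun i => ht (.inl i)
  have hw : ∀ i : Fin n, w i ^ ((i : ℕ) + 1) = 0 := fun i => ht (.inr i)
  have hzn : ∀ i : Fin n, z i ^ n = 0 := fun i => pow_eq_zero_of_le i.2 (hz i)
  have hwn : ∀ i : Fin n, w i ^ n = 0 := fun i => pow_eq_zero_of_le i.2 (hw i)
  set φ := algebraMap R S
  have hIK : dwPartition (φ x) (φ y) z w * (Matrix.vandermonde z).det *
      (Matrix.vandermonde w).det = _ := izerginKorepin (φ x) (φ y) z w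
  set g : Fin n → S := fun i => 1 - φ ((1 - ν) * x) * z i
  set k : Fin n → S := fun j => 1 - φ (1 - ν) * w j
  set AD : Fin n → Fin n → S := fun i j =>
    (1 - z i * w j) * (1 - φ x * z i - w j - (φ y - φ x) * (z i * w j))
  -- Multiplying by g(z_i)k(w_j) or by the full row product of ab scales rows and columns only; the
  -- entries then agree by `truncEval_mASM`, whose factor ab at (i, j) is the one the Izergin entry
  -- omits.
  have hdet : (∏ i, g i) * ((∏ j, k j) * (izerginMatrix (φ x) (φ y) z w).det) =
      (∏ i, ∏ l, AD i l) * (Matrix.of fun i j => truncEval (mASM x y ν) n (z i) (w j)).det := by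
    rw [← Matrix.det_mul_row, ← Matrix.det_mul_column, ← Matrix.det_mul_column]
    congr 1
    ext i j
    have h := truncEval_mASM x y ν hν n (z i) (w j) (hzn i) (hwn j)
    simp only [Matrix.of_apply, izerginMatrix]
    rw [← Finset.mul_prod_erase _ _ (Finset.mem_univ j)]
    linear_combination (-(∏ l ∈ Finset.univ.erase j, AD i l)) * h
  rw [det_of_truncEval, ← hIK, det_vandermonde_of_pow_eq_zero z hz,
    det_vandermonde_of_pow_eq_zero w hw] at hdet
  set VV : S := (∏ i, z i ^ (i : ℕ)) * ∏ i, w i ^ (i : ℕ) with hVV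
  -- The annihilator of `VV`. Working modulo it cancels the Vandermondes and sets every z_i and w_i
  -- to 0, so `g`, `k` and `AD` all become 1.
  let J : Ideal S := LinearMap.ker (LinearMap.toSpanSingleton S S VV)
  have hJ : ∀ s : S, s ∈ J ↔ s * VV = 0 := fun s => by
    simp [J, LinearMap.toSpanSingleton_apply]
  have hzJ : ∀ i, Ideal.Quotient.mk J (z i) = 0 := fun i => by
    rw [Ideal.Quotient.eq_zero_iff_mem, hJ, hVV, ← mul_assoc, mul_prod_pow_eq_zero z hz, zero_mul]
  have hwJ : ∀ i, Ideal.Quotient.mk J (w i) = 0 := fun i => by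
    rw [Ideal.Quotient.eq_zero_iff_mem, hJ, hVV, mul_left_comm, mul_prod_pow_eq_zero w hw, mul_zero]
  have hmem : (∏ i, g i) * (∏ j, k j) * dwPartition (φ x) (φ y) z w -
      (∏ i, ∏ l, AD i l) * φ (principalMinor (mASM x y ν) n) ∈ J := by
    rw [hJ]
    linear_combination hdet
  have h0 : φ (dwPartition x y (fun _ : Fin n => 0) (fun _ : Fin n => 0) -
      principalMinor (mASM x y ν) n) ∈ J := by
    rw [← Ideal.Quotient.eq_zero_iff_mem] at hmem ⊢
    rw [← hmem]
    simp [map_dwPartition, g, k, AD, hzJ, hwJ]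
  rw [hJ] at h0
  refine sub_eq_zero.1 (hinj _ ?_)
  rw [Fintype.prod_sum_type]
  exact h0

end Specialization

/-! ### Alternating lines and their edge states. -/

section PartialSums

variable {n : ℕ}

/-- The sum of the entries of `f` before position `i`. -/
def initialSum (f : Fin n → ℤ) (i : Fin (n + 1)) : ℤ :=
  ∑ k with k.castSucc < i, f k

theorem initialSum_zero (f : Fin n → ℤ) : initialSum f 0 = 0 := by
  simp [initialSum]

theorem initialSum_last (f : Fin n → ℤ) : initialSum f (Fin.last n) = ∑ k, f k := by
  simp [initialSum, Fin.castSucc_lt_last]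

theorem initialSum_succ_eq_Iic (f : Fin n → ℤ) (k : Fin n) :
    initialSum f k.succ = ∑ l ∈ Finset.Iic k, f l := by
  rw [initialSum]
  congr 1
  ext l
  simp [Fin.castSucc_lt_succ_iff]

theorem initialSum_succ (f : Fin n → ℤ) (k : Fin n) :
    initialSum f k.succ = initialSum f k.castSucc + f k := by
  have e : (Finset.univ.filter fun l : Fin n => l.castSucc < k.succ) =
      insert k (Finset.univ.filter fun l : Fin n => l.castSucc < k.castSucc) := by
    ext l
    simp [Fin.castSucc_lt_succ_iff, le_iff_eq_or_lt]
  rw [initialSum, e, Finset.sum_insert (by simp), add_comm]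
  rfl

theorem sum_Ioi_eq (f : Fin n → ℤ) (k : Fin n) :
    ∑ l ∈ Finset.Ioi k, f l = ∑ l, f l - initialSum f k.succ := by
  rw [initialSum_succ_eq_Iic, eq_sub_iff_add_eq', ← Finset.sum_union]
  · congr 1
    ext l
    simp [le_or_gt]
  · exact Finset.disjoint_left.2 fun l h1 h2 => by
      simp only [Finset.mem_Iic, Finset.mem_Ioi] at h1 h2
      exact absurd h1 (not_le.2 h2)

theorem initialSum_eq_of_sub (f : Fin n → ℤ) (c : Fin (n + 1) → ℤ) (h0 : c 0 = 0)
    (h : ∀ k, f k = c k.succ - c k.castSucc) (i : Fin (n + 1)) : initialSum f i = c i := by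
  induction i using Fin.induction with
  | zero => rw [initialSum_zero, h0]
  | succ k ih => rw [initialSum_succ, ih, h]; ring

/-- A line of an alternating sign matrix. -/
def IsAlternating (f : Fin n → ℤ) : Prop :=
  ∑ k, f k = 1 ∧ ∀ i, initialSum f i = 0 ∨ initialSum f i = 1

theorem isAlternating_of_isASM_row {B : Matrix (Fin n) (Fin n) ℤ} (hB : IsASM B) (i : Fin n) :
    IsAlternating fun j => B i j := by
  refine ⟨hB.row_sum i, fun k => ?_⟩
  refine Fin.cases (.inl (initialSum_zero _)) (fun k => ?_) k
  have := hB.row_partial i k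
  rw [initialSum_succ_eq_Iic]
  omega

theorem isAlternating_of_isASM_col {B : Matrix (Fin n) (Fin n) ℤ} (hB : IsASM B) (j : Fin n) :
    IsAlternating fun i => B i j := by
  refine ⟨hB.col_sum j, fun k => ?_⟩
  refine Fin.cases (.inl (initialSum_zero _)) (fun k => ?_) k
  have := hB.col_partial j k
  rw [initialSum_succ_eq_Iic]
  omega

theorem isAlternating_of_sub (f : Fin n → ℤ) (c : Fin (n + 1) → Bool) (h0 : c 0 = false)
    (h1 : c (Fin.last n) = true) (h : ∀ k, f k = (c k.succ).toNat - (c k.castSucc).toNat) :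
    IsAlternating f := by
  have hc := initialSum_eq_of_sub f (fun i => ((c i).toNat : ℤ)) (by simp [h0]) h
  refine ⟨?_, fun i => ?_⟩
  · rw [← initialSum_last, hc, h1]
    rfl
  · rw [hc]
    cases c i <;> simp

theorem isASM_of_isAlternating {B : Matrix (Fin n) (Fin n) ℤ}
    (hr : ∀ i, IsAlternating fun j => B i j) (hc : ∀ j, IsAlternating fun i => B i j) :
    IsASM B where
  entries i j := by
    have h := initialSum_succ (fun j => B i j) j
    have h1 := (hr i).2 j.succ
    have h2 := (hr i).2 j.castSucc
    simp only [Finset.mem_insert, Finset.mem_singleton]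
    omega
  row_sum i := (hr i).1
  col_sum j := (hc j).1
  row_partial i k := by
    rw [← initialSum_succ_eq_Iic (fun j => B i j)]
    have := (hr i).2 k.succ
    omega
  col_partial j k := by
    rw [← initialSum_succ_eq_Iic (fun i => B i j)]
    have := (hc j).2 k.succ
    omega

/-- The states of the edges along a line with entries `f`. -/
def edgeStates (f : Fin n → ℤ) (i : Fin (n + 1)) : Bool :=
  decide (initialSum f i = 1)

theorem toNat_edgeStates {f : Fin n → ℤ} (hf : IsAlternating f) (i : Fin (n + 1)) :
    ((edgeStates f i).toNat : ℤ) = initialSum f i := by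
  rcases hf.2 i with h | h <;> simp [edgeStates, h]

theorem edgeStates_zero (f : Fin n → ℤ) : edgeStates f 0 = false := by
  simp [edgeStates, initialSum_zero]

theorem edgeStates_last {f : Fin n → ℤ} (hf : IsAlternating f) :
    edgeStates f (Fin.last n) = true := by
  simp [edgeStates, initialSum_last, hf.1]

theorem edgeStates_succ_sub {f : Fin n → ℤ} (hf : IsAlternating f) (k : Fin n) :
    ((edgeStates f k.succ).toNat : ℤ) - (edgeStates f k.castSucc).toNat = f k := by
  rw [toNat_edgeStates hf, toNat_edgeStates hf, initialSum_succ]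
  ring

theorem edgeStates_of_sub (f : Fin n → ℤ) (c : Fin (n + 1) → Bool) (h0 : c 0 = false)
    (h : ∀ k, f k = (c k.succ).toNat - (c k.castSucc).toNat) : edgeStates f = c := by
  ext i
  rw [edgeStates, initialSum_eq_of_sub f (fun i => ((c i).toNat : ℤ)) (by simp [h0]) h]
  cases c i <;> simp

end PartialSums

/-! ### The bijection between alternating sign matrices and six-vertex states. -/

section Configurations

variable {n : ℕ}

/-- Configurations of the six-vertex model with domain wall boundary conditions, given by the
states of the vertical edges `c.1 i j` and of the horizontal edges `c.2 i j`. -/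
structure IsConfiguration
    (c : (Fin (n + 1) → Fin n → Bool) × (Fin n → Fin (n + 1) → Bool)) : Prop where
  top : c.1 0 = fun _ => false
  bottom : c.1 (Fin.last n) = fun _ => true
  left : ∀ i, c.2 i 0 = false
  right : ∀ i, c.2 i (Fin.last n) = true
  vertex : ∀ i j, ((c.2 i j.succ).toNat : ℤ) - (c.2 i j.castSucc).toNat =
    (c.1 i.succ j).toNat - (c.1 i.castSucc j).toNat

/-- The alternating sign matrix of a configuration. -/
def configurationMatrix (c : (Fin (n + 1) → Fin n → Bool) × (Fin n → Fin (n + 1) → Bool)) :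
    Matrix (Fin n) (Fin n) ℤ :=
  Matrix.of fun i j => (c.1 i.succ j).toNat - (c.1 i.castSucc j).toNat

/-- The configuration of an alternating sign matrix. -/
def matrixConfiguration (B : Matrix (Fin n) (Fin n) ℤ) :
    (Fin (n + 1) → Fin n → Bool) × (Fin n → Fin (n + 1) → Bool) :=
  (fun i j => edgeStates (fun k => B k j) i, fun i => edgeStates fun j => B i j)

theorem IsConfiguration.isAlternating_row
    {c : (Fin (n + 1) → Fin n → Bool) × (Fin n → Fin (n + 1) → Bool)} (hc : IsConfiguration c)
    (i : Fin n) : IsAlternating fun j => configurationMatrix c i j :=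
  isAlternating_of_sub _ (c.2 i) (hc.left i) (hc.right i) fun k => (hc.vertex i k).symm

theorem IsConfiguration.isAlternating_col
    {c : (Fin (n + 1) → Fin n → Bool) × (Fin n → Fin (n + 1) → Bool)} (hc : IsConfiguration c)
    (j : Fin n) : IsAlternating fun i => configurationMatrix c i j :=
  isAlternating_of_sub _ (fun i => c.1 i j) (congrFun hc.top j) (congrFun hc.bottom j) fun _ => rfl

theorem IsConfiguration.isASM
    {c : (Fin (n + 1) → Fin n → Bool) × (Fin n → Fin (n + 1) → Bool)} (hc : IsConfiguration c) :
    IsASM (configurationMatrix c) :=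
  isASM_of_isAlternating hc.isAlternating_row hc.isAlternating_col

theorem IsConfiguration.matrixConfiguration_configurationMatrix
    {c : (Fin (n + 1) → Fin n → Bool) × (Fin n → Fin (n + 1) → Bool)} (hc : IsConfiguration c) :
    matrixConfiguration (configurationMatrix c) = c := by
  refine Prod.ext ?_ ?_
  · ext i j
    exact congrFun (edgeStates_of_sub (fun k => configurationMatrix c k j) (fun i => c.1 i j)
      (congrFun hc.top j) fun _ => rfl) i
  · ext i j
    exact congrFun (edgeStates_of_sub (fun k => configurationMatrix c i k) (c.2 i) (hc.left i)
      fun k => (hc.vertex i k).symm) j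

theorem IsASM.isConfiguration {B : Matrix (Fin n) (Fin n) ℤ} (hB : IsASM B) :
    IsConfiguration (matrixConfiguration B) where
  top := funext fun _ => edgeStates_zero _
  bottom := funext fun j => edgeStates_last (isAlternating_of_isASM_col hB j)
  left _ := edgeStates_zero _
  right i := edgeStates_last (isAlternating_of_isASM_row hB i)
  vertex i j := (edgeStates_succ_sub (isAlternating_of_isASM_row hB i) j).trans
    (edgeStates_succ_sub (isAlternating_of_isASM_col hB j) i).symm

theorem IsASM.configurationMatrix_matrixConfiguration {B : Matrix (Fin n) (Fin n) ℤ}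
    (hB : IsASM B) : configurationMatrix (matrixConfiguration B) = B := by
  ext i j
  exact edgeStates_succ_sub (isAlternating_of_isASM_col hB j) i

theorem vertexWeight_zero_zero {R : Type*} [CommRing R] (x y : R) {h v h' v' : Bool}
    (e : (h'.toNat : ℤ) - h.toNat = v'.toNat - v.toNat) :
    vertexWeight x y 0 0 h v h' v' =
      x ^ (if (v'.toNat : ℤ) - v.toNat = -1 then 1 else 0) *
        y ^ (if (v'.toNat : ℤ) - v.toNat = 0 ∧ h' = false ∧ v' = false then 1 else 0) := by
  cases h <;> cases v <;> cases h' <;> cases v' <;> simp [vertexWeight] at e ⊢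

theorem vertexWeight_eq_zero {R : Type*} [CommRing R] (x y z w : R) {h v h' v' : Bool}
    (e : (h'.toNat : ℤ) - h.toNat ≠ v'.toNat - v.toNat) :
    vertexWeight x y z w h v h' v' = 0 := by
  cases h <;> cases v <;> cases h' <;> cases v' <;> simp [vertexWeight] at e ⊢

/-- Inv is the sum over cells of (entries to the right) times (entries below), that is, of (1 -
h')(1 - v'). It counts the cells whose right and lower edges are both `false`: those with entry -1,
and those with entry 0 of weight y. -/
theorem IsConfiguration.asmInv_eq
    {c : (Fin (n + 1) → Fin n → Bool) × (Fin n → Fin (n + 1) → Bool)} (hc : IsConfiguration c) :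
    asmInv (configurationMatrix c) = asmN (configurationMatrix c) +
      ((∑ i, ∑ j, if configurationMatrix c i j = 0 ∧ c.2 i j.succ = false ∧ c.1 i.succ j = false
        then 1 else 0 : ℕ) : ℤ) := by
  have hr : ∀ i j, ∑ l ∈ Finset.Ioi j, configurationMatrix c i l = 1 - (c.2 i j.succ).toNat := by
    intro i j
    rw [sum_Ioi_eq (fun j => configurationMatrix c i j), (hc.isAlternating_row i).1,
      initialSum_eq_of_sub (fun j => configurationMatrix c i j)
        (fun j => ((c.2 i j).toNat : ℤ)) (by simp [hc.left])
        fun k => (hc.vertex i k).symm]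
  have hl : ∀ i j, ∑ l ∈ Finset.Ioi i, configurationMatrix c l j = 1 - (c.1 i.succ j).toNat := by
    intro i j
    rw [sum_Ioi_eq (fun i => configurationMatrix c i j), (hc.isAlternating_col j).1,
      initialSum_eq_of_sub (fun i => configurationMatrix c i j)
        (fun i => ((c.1 i j).toNat : ℤ)) (by simp [hc.top]) fun k => rfl]
  rw [asmInv, asmN, Finset.card_filter, Fintype.sum_prod_type, ← Nat.cast_add,
    ← Finset.sum_add_distrib]
  push_cast
  refine Finset.sum_congr rfl fun i _ => ?_
  rw [← Finset.sum_add_distrib]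
  refine Finset.sum_congr rfl fun j _ => ?_
  rw [Finset.sum_comm, ← Finset.sum_mul_sum, hr, hl]
  have e := hc.vertex i j
  have e' : configurationMatrix c i j = (c.1 i.succ j).toNat - (c.1 i.castSucc j).toNat := rfl
  rw [e']
  generalize c.1 i.succ j = v' at *
  generalize c.1 i.castSucc j = v at *
  generalize c.2 i j.succ = h' at *
  generalize c.2 i j.castSucc = h at *
  cases h <;> cases v <;> cases h' <;> cases v' <;> simp at e ⊢

theorem IsConfiguration.prod_vertexWeight {R : Type*} [CommRing R] (x y : R)
    {c : (Fin (n + 1) → Fin n → Bool) × (Fin n → Fin (n + 1) → Bool)} (hc : IsConfiguration c) :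
    ∏ i, ∏ j, vertexWeight x y 0 0 (c.2 i j.castSucc) (c.1 i.castSucc j) (c.2 i j.succ)
      (c.1 i.succ j) = x ^ asmN (configurationMatrix c) *
        y ^ (asmInv (configurationMatrix c) - (asmN (configurationMatrix c) : ℤ)).toNat := by
  rw [hc.asmInv_eq, add_sub_cancel_left, Int.toNat_natCast, asmN, Finset.card_filter,
    Fintype.sum_prod_type]
  simp only [vertexWeight_zero_zero x y (hc.vertex _ _), Finset.prod_mul_distrib,
    Finset.prod_pow_eq_pow_sum]
  rfl

theorem dwPartition_eq_sum {R : Type*} [CommRing R] (x y : R) (z w : Fin n → R) :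
    dwPartition x y z w =
      ∑ c : (Fin (n + 1) → Fin n → Bool) × (Fin n → Fin (n + 1) → Bool),
        if (c.1 0 = fun _ => false) ∧ (c.1 (Fin.last n) = fun _ => true) ∧
          ∀ i, c.2 i 0 = false ∧ c.2 i (Fin.last n) = true then
        ∏ i, ∏ j, vertexWeight x y (z i) (w j) (c.2 i j.castSucc) (c.1 i.castSucc j) (c.2 i j.succ)
          (c.1 i.succ j) else 0 := by
  rw [dwPartition, list_ofFn_prod_apply, Fintype.sum_prod_type]
  refine Finset.sum_congr rfl fun v _ => ?_
  simp only [rowTransfer, Matrix.of_apply, rowMonodromy, list_ofFn_prod_apply, vertexMatrix]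
  rw [Finset.prod_univ_sum, Fintype.piFinset_univ]
  simp only [Finset.prod_ite_zero, Finset.mem_univ, true_imp_iff]
  by_cases h : (v 0 = fun _ => false) ∧ v (Fin.last n) = fun _ => true
  · simp [h]
  · rw [if_neg h]
    refine (Finset.sum_eq_zero fun u _ => if_neg fun h' => h ⟨h'.1, h'.2.1⟩).symm

theorem dwPartition_zero_eq_zASM {R : Type*} [CommRing R] (x y : R) (n : ℕ) :
    dwPartition x y (fun _ : Fin n => 0) (fun _ : Fin n => 0) = zASM n x y := by
  classical
  have e : dwPartition x y (fun _ : Fin n => 0) (fun _ : Fin n => 0) =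
      ∑ c : (Fin (n + 1) → Fin n → Bool) × (Fin n → Fin (n + 1) → Bool) with IsConfiguration c,
        x ^ asmN (configurationMatrix c) *
        y ^ (asmInv (configurationMatrix c) - (asmN (configurationMatrix c) : ℤ)).toNat := by
    rw [dwPartition_eq_sum, Finset.sum_filter]
    refine Finset.sum_congr rfl fun c _ => ?_
    by_cases hc : IsConfiguration c
    · rw [if_pos hc, if_pos ⟨hc.top, hc.bottom, fun i => ⟨hc.left i, hc.right i⟩⟩,
        hc.prod_vertexWeight]
    · rw [if_neg hc]
      split_ifs with h
      -- With the boundary conditions satisfied, only the vertex rule can fail, and a vertex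
      -- violating it has weight 0.
      · obtain ⟨i, j, hij⟩ : ∃ i j, ((c.2 i j.succ).toNat : ℤ) - (c.2 i j.castSucc).toNat ≠
            (c.1 i.succ j).toNat - (c.1 i.castSucc j).toNat := by
          by_contra! hv
          exact hc ⟨h.1, h.2.1, fun i => (h.2.2 i).1, fun i => (h.2.2 i).2, hv⟩
        exact Finset.prod_eq_zero (Finset.mem_univ i)
          (Finset.prod_eq_zero (Finset.mem_univ j) (vertexWeight_eq_zero _ _ _ _ hij))
      · rfl
  rw [e, zASM]
  refine Finset.sum_nbij' configurationMatrix matrixConfiguration ?_ ?_ ?_ ?_ fun _ _ => rfl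
  · intro c hc
    exact (mem_asmFinset _).2 (Finset.mem_filter.1 hc).2.isASM
  · intro B hB
    exact Finset.mem_filter.2 ⟨Finset.mem_univ _, ((mem_asmFinset B).1 hB).isConfiguration⟩
  · intro c hc
    exact (Finset.mem_filter.1 hc).2.matrixConfiguration_configurationMatrix
  · intro B hB
    exact ((mem_asmFinset B).1 hB).configurationMatrix_matrixConfiguration

end Configurations

theorem mainTheorem2 {R : Type*} [CommRing R] (x y ν : R)
    (hν : x * ν * (1 - ν) = ν + y * (1 - ν)) :
    doubleGenFun (mASM x y ν) =
        MvPowerSeries.C (1 - ν) * diagSeries R + MvPowerSeries.C ν * transferSeries x y ∧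
      ∀ n : ℕ, zASM n x y = principalMinor (mASM x y ν) n :=
  ⟨doubleGenFun_mASM x y ν, fun n =>
    (dwPartition_zero_eq_zASM x y n).symm.trans (dwPartition_zero_eq_principalMinor x y ν hν n)⟩
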